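/- Let $\Omega\subseteq\mathbb{R}^n$. An interval function on $\Omega$ is a map $f=[\underline f,\overline f]$ from $\Omega$ to the compact real intervals, with $\underline f\le\overline f$. It is locally bounded if every $x\in\Omega$ has $\delta>0$ and $M$ with $\max\{|\underline f(y)|,|\overline f(y)|\}<M$ for all $y\in B_\delta(x)=\{y\in\Omega:\|x-y\|<\delta\}$. For locally bounded $f$ put $$F(f)(x)=\Big[\sup_{\delta>0}\inf_{y\in B_\delta(x)}\underline f(y),\ \inf_{\delta>0}\sup_{y\in B_\delta(x)}\overline f(y)\Big].$$ A locally bounded $f$ is Hausdorff continuous if $F(g)=f$ for every locally bounded interval function $g$ with $g(x)\subseteq f(x)$ for all $x\in\Omega$. Let $\mathbb{H}(\Omega)$ be the set of Hausdorff continuous functions, ordered by $f\le g$ iff $\underline f\le\underline g$ and $\overline f\le\overline g$ pointwise; $C(\Omega)$, the set of continuous real functions, is regarded as a subset of $\mathbb{H}(\Omega)$ by identifying $a$ with $[a,a]$. Intervals are added and multiplied by $a+b=\{s+t:s\in a,\,t\in b\}$ and $a\times b=\{st:s\in a,\,t\in b\}$. A sequence $(\xi_k)$ in a partially ordered set order converges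 to $p$ if there are an increasing sequence $(\alpha_k)$ and a decreasing sequence $(\beta_k)$ with $\alpha_k\le\xi_k\le\beta_k$ for all $k$ and $\sup_k\alpha_k=p=\inf_k\beta_k$. A sequence $(f_k)$ in $C(\Omega)$ is Cauchy if there is a decreasing sequence $(\beta_k)$ in $C(\Omega)$ with infimum $0$ in $C(\Omega)$ such that $f_m-f_l\le\beta_k$ whenever $m,l\ge k$. Let $f,g\in\mathbb{H}(\Omega)$. Then: 1. There is exactly one $h\in\mathbb{H}(\Omega)$ with $h(x)\subseteq f(x)+g(x)$ for all $x\in\Omega$, and exactly one $q\in\mathbb{H}(\Omega)$ with $q(x)\subseteq f(x)\times g(x)$ for all $x\in\Omega$. 2. There are Cauchy sequences $(f_k)$, $(g_k)$ in $C(\Omega)$ which order converge in $\mathbb{H}(\Omega)$ to $f$ and $g$, respectively; and for every choice of such sequences, $(f_k+g_k)$ and $(f_k g_k)$ order converge in $\mathbb{H}(\Omega)$, each to exactly one limit, which does not depend on the choice. 3. The two ways of defining sum and product agree: the limit of $(f_k+g_k)$ is $h$ and the limit of $(f_kg_k)$ is $q$. -/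

import Mathlib

namespace HausdorffContinuity

/-- `NonemptyInterval ℝ` is the set of all compact real intervals `[a.fst, a.snd]`,
`a.fst ≤ a.snd`; its addition is `[a.fst + b.fst, a.snd + b.snd]`. (Its `≤` in Mathlib is
inclusion, which is not the order used here for functions; inclusion is written with sets.)
The outer product of two intervals: -/
def intervalMul (a b : NonemptyInterval ℝ) : NonemptyInterval ℝ where
  fst := min (min (a.fst * b.fst) (a.fst * b.snd)) (min (a.snd * b.fst) (a.snd * b.snd))
  snd := max (max (a.fst * b.fst) (a.fst * b.snd)) (max (a.snd * b.fst) (a.snd * b.snd))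
  fst_le_snd :=
    ((min_le_left _ _).trans (min_le_left _ _)).trans
      ((le_max_left _ _).trans (le_max_left _ _))

section Baire

variable {X : Type*} [PseudoMetricSpace X]

/-- Local boundedness, with the modulus `|a| = max |a.fst| |a.snd|` of an interval. -/
def LocallyBounded (f : X → NonemptyInterval ℝ) : Prop :=
  ∀ x, ∃ δ > 0, ∃ M : ℝ, ∀ y ∈ Metric.ball x δ, max |(f y).fst| |(f y).snd| < M

/-- `sup_{δ > 0} inf {f y : y ∈ B_δ(x)}`, computed in the extended reals because the infimum
may be `-∞` for large `δ`; for a locally bounded `f` the outcome is finite. -/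
noncomputable def lowerBaire (f : X → NonemptyInterval ℝ) (x : X) : ℝ :=
  (⨆ δ : ℝ, ⨆ _ : 0 < δ, ⨅ y ∈ Metric.ball x δ, ((f y).fst : EReal)).toReal

/-- `inf_{δ > 0} sup {f y : y ∈ B_δ(x)}`, computed in the extended reals. -/
noncomputable def upperBaire (f : X → NonemptyInterval ℝ) (x : X) : ℝ :=
  (⨅ δ : ℝ, ⨅ _ : 0 < δ, ⨆ y ∈ Metric.ball x δ, ((f y).snd : EReal)).toReal

theorem le_lowerBaire {f : X → NonemptyInterval ℝ} {x : X} {c δ : ℝ} (hδ : 0 < δ)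
    (h : ∀ y ∈ Metric.ball x δ, c ≤ (f y).fst) : c ≤ lowerBaire f x := by
  have h1 : (c : EReal) ≤
      ⨆ δ : ℝ, ⨆ _ : 0 < δ, ⨅ y ∈ Metric.ball x δ, ((f y).fst : EReal) :=
    le_iSup₂_of_le δ hδ (le_iInf₂ fun y hy => EReal.coe_le_coe_iff.2 (h y hy))
  have h2 : (⨆ δ : ℝ, ⨆ _ : 0 < δ, ⨅ y ∈ Metric.ball x δ, ((f y).fst : EReal))
      ≤ ((f x).fst : EReal) :=
    iSup₂_le fun δ hδ => iInf₂_le x (Metric.mem_ball_self hδ)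
  have h3 := EReal.toReal_le_toReal h1 (EReal.coe_ne_bot c)
    (ne_top_of_le_ne_top (EReal.coe_ne_top _) h2)
  simpa [lowerBaire] using h3

theorem upperBaire_le {f : X → NonemptyInterval ℝ} {x : X} {c δ : ℝ} (hδ : 0 < δ)
    (h : ∀ y ∈ Metric.ball x δ, (f y).snd ≤ c) : upperBaire f x ≤ c := by
  have h1 : (⨅ δ : ℝ, ⨅ _ : 0 < δ, ⨆ y ∈ Metric.ball x δ, ((f y).snd : EReal)) ≤ (c : EReal) :=
    iInf₂_le_of_le δ hδ (iSup₂_le fun y hy => EReal.coe_le_coe_iff.2 (h y hy))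
  have h2 : ((f x).snd : EReal) ≤
      ⨅ δ : ℝ, ⨅ _ : 0 < δ, ⨆ y ∈ Metric.ball x δ, ((f y).snd : EReal) :=
    le_iInf₂ fun δ hδ => le_iSup₂_of_le x (Metric.mem_ball_self hδ) le_rfl
  have h3 := EReal.toReal_le_toReal h1
    (ne_bot_of_le_ne_bot (EReal.coe_ne_bot _) h2) (EReal.coe_ne_top c)
  simpa [upperBaire] using h3

theorem lowerBaire_le {f : X → NonemptyInterval ℝ} (hf : LocallyBounded f) (x : X) :
    lowerBaire f x ≤ (f x).fst := by
  obtain ⟨δ, hδ, M, hM⟩ := hf x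
  have h1 : ((-M : ℝ) : EReal) ≤
      ⨆ δ : ℝ, ⨆ _ : 0 < δ, ⨅ y ∈ Metric.ball x δ, ((f y).fst : EReal) :=
    le_iSup₂_of_le δ hδ (le_iInf₂ fun y hy => EReal.coe_le_coe_iff.2
      (abs_le.1 ((le_max_left _ _).trans (hM y hy).le)).1)
  have h2 : (⨆ δ : ℝ, ⨆ _ : 0 < δ, ⨅ y ∈ Metric.ball x δ, ((f y).fst : EReal))
      ≤ ((f x).fst : EReal) :=
    iSup₂_le fun δ hδ => iInf₂_le x (Metric.mem_ball_self hδ)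
  have h3 := EReal.toReal_le_toReal h2
    (ne_bot_of_le_ne_bot (EReal.coe_ne_bot _) h1) (EReal.coe_ne_top _)
  simpa [lowerBaire] using h3

theorem le_upperBaire {f : X → NonemptyInterval ℝ} (hf : LocallyBounded f) (x : X) :
    (f x).snd ≤ upperBaire f x := by
  obtain ⟨δ, hδ, M, hM⟩ := hf x
  have h1 : (⨅ δ : ℝ, ⨅ _ : 0 < δ, ⨆ y ∈ Metric.ball x δ, ((f y).snd : EReal)) ≤ (M : EReal) :=
    iInf₂_le_of_le δ hδ (iSup₂_le fun y hy => EReal.coe_le_coe_iff.2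
      (abs_le.1 ((le_max_right _ _).trans (hM y hy).le)).2)
  have h2 : ((f x).snd : EReal) ≤
      ⨅ δ : ℝ, ⨅ _ : 0 < δ, ⨆ y ∈ Metric.ball x δ, ((f y).snd : EReal) :=
    le_iInf₂ fun δ hδ => le_iSup₂_of_le x (Metric.mem_ball_self hδ) le_rfl
  have h3 := EReal.toReal_le_toReal h2 (EReal.coe_ne_bot _)
    (ne_top_of_le_ne_top (EReal.coe_ne_top _) h1)
  simpa [upperBaire] using h3

/-- The graph completion `F(f) = [I(f), S(f)]` of a locally bounded interval function. -/
noncomputable def graphCompletion (f : X → NonemptyInterval ℝ) (hf : LocallyBounded f) (x : X) :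
    NonemptyInterval ℝ where
  fst := lowerBaire f x
  snd := upperBaire f x
  fst_le_snd := (lowerBaire_le hf x).trans ((f x).fst_le_snd.trans (le_upperBaire hf x))

end Baire

/-- The set of all Hausdorff continuous interval functions on `X`. -/
@[ext]
structure HFun (X : Type*) [PseudoMetricSpace X] where
  toFun : X → NonemptyInterval ℝ
  locallyBounded : LocallyBounded toFun
  hausdorff : ∀ (g : X → NonemptyInterval ℝ) (hg : LocallyBounded g),
    (∀ x, (g x : Set ℝ) ⊆ (toFun x : Set ℝ)) → ∀ x, graphCompletion g hg x = toFun x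

section HFun

variable {X : Type*} [PseudoMetricSpace X]

instance : CoeFun (HFun X) (fun _ => X → NonemptyInterval ℝ) := ⟨HFun.toFun⟩

/-- `f ≤ g` iff, at every point, both end points of `f` are at most those of `g`. -/
instance : PartialOrder (HFun X) where
  le f g := ∀ x, (f x).fst ≤ (g x).fst ∧ (f x).snd ≤ (g x).snd
  le_refl _ _ := ⟨le_rfl, le_rfl⟩
  le_trans _ _ _ h k x := ⟨(h x).1.trans (k x).1, (h x).2.trans (k x).2⟩
  le_antisymm f g h k := HFun.ext <| funext fun x => NonemptyInterval.ext <|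
    Prod.ext (le_antisymm (h x).1 (k x).1) (le_antisymm (h x).2 (k x).2)

/-- A continuous real function, regarded as a (point-valued) Hausdorff continuous function. -/
def ofContinuous (u : C(X, ℝ)) : HFun X where
  toFun x := NonemptyInterval.pure (u x)
  locallyBounded x := by
    obtain ⟨δ, hδ, h⟩ := Metric.continuousAt_iff.1 (u.continuous.continuousAt (x := x)) 1 one_pos
    refine ⟨δ, hδ, |u x| + 1, fun y hy => ?_⟩
    have h1 : |u y - u x| < 1 := h hy
    have h2 := abs_sub_abs_le_abs_sub (u y) (u x)
    change max |u y| |u y| < |u x| + 1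
    rw [max_self]
    linarith
  hausdorff g hg hgu x := by
    have hval : ∀ y, (g y).fst = u y ∧ (g y).snd = u y := by
      intro y
      have h1 : (g y).fst ∈ (NonemptyInterval.pure (u y) : Set ℝ) :=
        hgu y ⟨le_rfl, (g y).fst_le_snd⟩
      have h2 : (g y).snd ∈ (NonemptyInterval.pure (u y) : Set ℝ) :=
        hgu y ⟨(g y).fst_le_snd, le_rfl⟩
      simpa using And.intro h1 h2
    have key : ∀ ε > 0, ∃ δ > 0, ∀ y ∈ Metric.ball x δ, |u y - u x| < ε := fun ε hε =>
      (Metric.continuousAt_iff.1 (u.continuous.continuousAt (x := x)) ε hε).imp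
        fun δ h => ⟨h.1, fun y hy => h.2 hy⟩
    refine NonemptyInterval.ext (Prod.ext (le_antisymm ?_ ?_) (le_antisymm ?_ ?_))
    · exact (lowerBaire_le hg x).trans (hval x).1.le
    · refine le_of_forall_pos_sub_le fun ε hε => ?_
      obtain ⟨δ, hδ, h⟩ := key ε hε
      refine le_lowerBaire hδ fun y hy => ?_
      rw [(hval y).1]
      have := (abs_lt.1 (h y hy)).1
      change u x - ε ≤ u y
      linarith
    · refine le_of_forall_pos_le_add fun ε hε => ?_
      obtain ⟨δ, hδ, h⟩ := key ε hε
      refine upperBaire_le hδ fun y hy => ?_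
      rw [(hval y).2]
      have := (abs_lt.1 (h y hy)).2
      change u y ≤ u x + ε
      linarith
    · exact (hval x).2.ge.trans (le_upperBaire hg x)

end HFun

/-- Order convergence of a sequence in a partially ordered set. -/
def OrderConverges {P : Type*} [PartialOrder P] (ξ : ℕ → P) (p : P) : Prop :=
  ∃ α β : ℕ → P, Monotone α ∧ Antitone β ∧ (∀ n, α n ≤ ξ n ∧ ξ n ≤ β n) ∧
    IsLUB (Set.range α) p ∧ IsGLB (Set.range β) p

/-- `p` is the order limit of `ξ`: `ξ` order converges to `p` and to nothing else. -/
def IsTheOrderLimit {P : Type*} [PartialOrder P] (ξ : ℕ → P) (p : P) : Prop :=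
  OrderConverges ξ p ∧ ∀ q, OrderConverges ξ q → q = p

section Operations

variable {X : Type*} [PseudoMetricSpace X]

/-- Cauchy sequences of continuous functions for the order convergence structure; the infimum
is taken in `C(X, ℝ)`. -/
def IsOrderCauchy (u : ℕ → C(X, ℝ)) : Prop :=
  ∃ β : ℕ → C(X, ℝ), Antitone β ∧ IsGLB (Set.range β) 0 ∧
    ∀ n m k, n ≤ m → n ≤ k → u m - u k ≤ β n

/-- `u` is a Cauchy sequence of continuous functions which order converges to `f` in the set of
Hausdorff continuous functions. -/
def Approximates (u : ℕ → C(X, ℝ)) (f : HFun X) : Prop :=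
  IsOrderCauchy u ∧ OrderConverges (fun n => ofContinuous (u n)) f

/-- `h(x) ⊆ f(x) + g(x)` for all `x`. -/
def IsInclusionSum (f g h : HFun X) : Prop :=
  ∀ x, (h x : Set ℝ) ⊆ ((f x + g x : NonemptyInterval ℝ) : Set ℝ)

/-- `h(x) ⊆ f(x) × g(x)` for all `x`. -/
def IsInclusionProd (f g h : HFun X) : Prop :=
  ∀ x, (h x : Set ℝ) ⊆ (intervalMul (f x) (g x) : Set ℝ)

/-- `h` is the sum of `f` and `g` defined through order convergence: approximating Cauchy
sequences exist, and for every choice of them `h` is the order limit of the sums. -/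
def IsOrderSum (f g h : HFun X) : Prop :=
  (∃ u v : ℕ → C(X, ℝ), Approximates u f ∧ Approximates v g) ∧
  ∀ u v : ℕ → C(X, ℝ), Approximates u f → Approximates v g →
    IsTheOrderLimit (fun n => ofContinuous (u n + v n)) h

/-- `h` is the product of `f` and `g` defined through order convergence: approximating Cauchy
sequences exist, and for every choice of them `h` is the order limit of the products. -/
def IsOrderProd (f g h : HFun X) : Prop :=
  (∃ u v : ℕ → C(X, ℝ), Approximates u f ∧ Approximates v g) ∧
  ∀ u v : ℕ → C(X, ℝ), Approximates u f → Approximates v g →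
    IsTheOrderLimit (fun n => ofContinuous (u n * v n)) h

end Operations

end HausdorffContinuity

/-
A Hausdorff continuous function is a pair of semicontinuous functions each of which is the envelope
of the other; in particular its values are short on a dense set of points. Call a decreasing
sequence of semicontinuous interval functions an enclosure if for every `ε > 0` the points at which
some term is shorter than `ε` are dense. At most one Hausdorff continuous function is contained in
all terms of an enclosure, and a sequence order converges to `p` exactly when some enclosure
contains `p` in all of its terms and the `n`-th member of the sequence in its `n`-th term.

The united extension of a continuous operation is inclusion monotone, preserves semicontinuity, and
by uniform continuity on compact boxes maps enclosures to enclosures. Applied to the constant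
enclosures `f` and `g` this shows that a result defined by inclusion is unique; applied to
enclosures witnessing `f_k → f` and `g_k → g` it shows that the same result is the order limit.
Approximating sequences are Lipschitz regularizations of the end points.
-/

namespace HausdorffContinuity

open Filter Topology

section Envelopes

variable {X : Type*} [TopologicalSpace X] {φ ψ u l : X → ℝ} {ε : ℝ}

/-- The upper semicontinuous majorants of `φ`. Their least element, when there is one, is the
upper semicontinuous envelope of `φ`. -/
def uscMajorants (φ : X → ℝ) : Set (X → ℝ) :=
  {ψ | UpperSemicontinuous ψ ∧ φ ≤ ψ}

/-- The lower semicontinuous minorants of `ψ`. Their greatest element, when there is one, is the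
lower semicontinuous envelope of `ψ`. -/
def lscMinorants (ψ : X → ℝ) : Set (X → ℝ) :=
  {φ | LowerSemicontinuous φ ∧ φ ≤ ψ}

theorem isLeast_uscMajorants_neg_iff :
    IsLeast (uscMajorants (-ψ)) (-l) ↔ IsGreatest (lscMinorants ψ) l := by
  constructor
  · rintro ⟨⟨hl, hle⟩, hleast⟩
    exact ⟨⟨upperSemiContinuous_neg_iff.1 hl, neg_le_neg_iff.1 hle⟩, fun φ hφ =>
      neg_le_neg_iff.1 (hleast ⟨hφ.1.neg, neg_le_neg hφ.2⟩)⟩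
  · rintro ⟨⟨hl, hle⟩, hgreatest⟩
    exact ⟨⟨hl.neg, neg_le_neg hle⟩, fun φ hφ =>
      neg_le.1 (hgreatest ⟨hφ.1.neg, neg_le.1 hφ.2⟩)⟩

theorem isGreatest_lscMinorants_neg_iff :
    IsGreatest (lscMinorants (-φ)) (-u) ↔ IsLeast (uscMajorants φ) u := by
  rw [← isLeast_uscMajorants_neg_iff, neg_neg, neg_neg]

theorem isLeast_sInf_uscMajorants (h : (uscMajorants φ).Nonempty) :
    IsLeast (uscMajorants φ) (sInf (uscMajorants φ)) := by
  have hbdd : BddBelow (uscMajorants φ) := ⟨φ, fun _ hψ => hψ.2⟩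
  refine ⟨⟨?_, le_csInf h fun _ hψ => hψ.2⟩, fun _ hψ => csInf_le hbdd hψ⟩
  have husc : UpperSemicontinuous fun x => ⨅ ψ : uscMajorants φ, (ψ : X → ℝ) x :=
    upperSemicontinuous_ciInf
      (fun x => ⟨φ x, Set.forall_mem_range.2 fun ψ => ψ.2.2 x⟩) fun ψ => ψ.2.1
  convert husc using 2 with x
  exact sInf_apply

theorem isGreatest_sSup_lscMinorants (h : (lscMinorants ψ).Nonempty) :
    IsGreatest (lscMinorants ψ) (sSup (lscMinorants ψ)) := by
  have hbdd : BddAbove (lscMinorants ψ) := ⟨ψ, fun _ hφ => hφ.2⟩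
  refine ⟨⟨?_, csSup_le h fun _ hφ => hφ.2⟩, fun _ hφ => le_csSup hbdd hφ⟩
  have hlsc : LowerSemicontinuous fun x => ⨆ φ : lscMinorants ψ, (φ : X → ℝ) x :=
    lowerSemicontinuous_ciSup
      (fun x => ⟨ψ x, Set.forall_mem_range.2 fun φ => φ.2.2 x⟩) fun φ => φ.2.1
  convert hlsc using 2 with x
  exact sSup_apply

theorem isLeast_uscMajorants_of_isGreatest (hφ : LowerSemicontinuous φ)
    (hu : IsLeast (uscMajorants φ) u) (hl : IsGreatest (lscMinorants u) l) :
    IsLeast (uscMajorants l) u :=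
  ⟨⟨hu.1.1, hl.1.2⟩, fun _ hψ => hu.2 ⟨hψ.1, (hl.2 ⟨hφ, hu.1.2⟩).trans hψ.2⟩⟩

theorem isOpen_sub_lt (hu : UpperSemicontinuous u) (hl : LowerSemicontinuous l) (ε : ℝ) :
    IsOpen {x | u x - l x < ε} := by
  have : {x | u x - l x < ε} = (u + -l) ⁻¹' Set.Iio ε := by
    ext x
    simp [sub_eq_add_neg]
  exact this ▸ (hu.add hl.neg).isOpen_preimage ε

theorem dense_sub_lt_of_isLeast (h : IsLeast (uscMajorants φ) u) (hε : 0 < ε) :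
    Dense {x | u x - φ x < ε} := by
  refine dense_iff_inter_open.2 fun U hU ⟨x, hx⟩ => ?_
  by_contra hempty
  -- Otherwise lowering `u` by `ε` on `U` would produce a smaller majorant.
  have hlower : u + U.indicator (fun _ => -ε) ∈ uscMajorants φ := by
    refine ⟨h.1.1.add (hU.upperSemicontinuous_indicator (neg_nonpos.2 hε.le)), fun y => ?_⟩
    by_cases hy : y ∈ U
    · have : ¬u y - φ y < ε := fun hlt => hempty ⟨y, hy, hlt⟩
      simp only [Pi.add_apply, Set.indicator_of_mem hy]
      linarith
    · simpa only [Pi.add_apply, Set.indicator_of_notMem hy, add_zero] using h.1.2 y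
  have := h.2 hlower x
  simp only [Pi.add_apply, Set.indicator_of_mem hx] at this
  linarith

theorem dense_sub_lt_of_isGreatest (h : IsGreatest (lscMinorants ψ) l) (hε : 0 < ε) :
    Dense {x | ψ x - l x < ε} := by
  simpa only [Pi.neg_apply, neg_sub_neg] using
    dense_sub_lt_of_isLeast (isLeast_uscMajorants_neg_iff.2 h) hε

end Envelopes

section Baire

variable {X : Type*} [PseudoMetricSpace X] {f : X → NonemptyInterval ℝ}

theorem LocallyBounded.neg (hf : LocallyBounded f) : LocallyBounded (-f) := fun x => by
  simpa only [Pi.neg_apply, NonemptyInterval.fst_neg, NonemptyInterval.snd_neg, abs_neg,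
    max_comm] using hf x

theorem lowerBaire_eq_toReal_liminf (f : X → NonemptyInterval ℝ) (x : X) :
    lowerBaire f x = (liminf (fun y => ((f y).fst : EReal)) (𝓝 x)).toReal :=
  congrArg EReal.toReal Metric.nhds_basis_ball.liminf_eq_iSup_iInf.symm

theorem upperBaire_eq_toReal_limsup (f : X → NonemptyInterval ℝ) (x : X) :
    upperBaire f x = (limsup (fun y => ((f y).snd : EReal)) (𝓝 x)).toReal :=
  congrArg EReal.toReal Metric.nhds_basis_ball.limsup_eq_iInf_iSup.symm

theorem lowerBaire_neg (f : X → NonemptyInterval ℝ) : lowerBaire (-f) = -upperBaire f := by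
  ext x
  rw [Pi.neg_apply, lowerBaire_eq_toReal_liminf, upperBaire_eq_toReal_limsup,
    ← EReal.toReal_neg_eq, ← EReal.liminf_neg]
  rfl

theorem coe_lowerBaire (hf : LocallyBounded f) (x : X) :
    (lowerBaire f x : EReal) = liminf (fun y => ((f y).fst : EReal)) (𝓝 x) := by
  obtain ⟨δ, hδ, M, hM⟩ := hf x
  have hbot : ((-M : ℝ) : EReal) ≤ liminf (fun y => ((f y).fst : EReal)) (𝓝 x) :=
    le_liminf_of_le (h := Filter.eventually_of_mem (Metric.ball_mem_nhds x hδ) fun y hy =>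
      EReal.coe_le_coe_iff.2 (abs_le.1 ((le_max_left _ _).trans (hM y hy).le)).1)
  have htop : liminf (fun y => ((f y).fst : EReal)) (𝓝 x) ≤ (f x).fst :=
    Metric.nhds_basis_ball.liminf_eq_iSup_iInf.trans_le <|
      iSup₂_le fun δ hδ => iInf₂_le x (Metric.mem_ball_self hδ)
  rw [lowerBaire_eq_toReal_liminf, EReal.coe_toReal]
  · exact ne_top_of_le_ne_top (EReal.coe_ne_top _) htop
  · exact ne_bot_of_le_ne_bot (EReal.coe_ne_bot _) hbot

theorem le_lowerBaire_of_eventually {x : X} {c : ℝ} (h : ∀ᶠ y in 𝓝 x, c ≤ (f y).fst) :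
    c ≤ lowerBaire f x := by
  obtain ⟨δ, hδ, hc⟩ := Metric.eventually_nhds_iff_ball.1 h
  exact le_lowerBaire hδ hc

theorem lowerSemicontinuous_lowerBaire (hf : LocallyBounded f) :
    LowerSemicontinuous (lowerBaire f) := by
  refine lowerSemicontinuous_iff.2 fun x c hc => ?_
  obtain ⟨d, hcd, hd⟩ := exists_between hc
  rw [← EReal.coe_lt_coe_iff, coe_lowerBaire hf] at hd
  filter_upwards [(eventually_lt_of_lt_liminf hd).eventually_nhds] with y hy
  exact hcd.trans_le <| le_lowerBaire_of_eventually <|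
    hy.mono fun _ h => (EReal.coe_lt_coe_iff.1 h).le

theorem isGreatest_lowerBaire (hf : LocallyBounded f) :
    IsGreatest (lscMinorants fun x => (f x).fst) (lowerBaire f) := by
  refine ⟨⟨lowerSemicontinuous_lowerBaire hf, lowerBaire_le hf⟩, fun φ hφ x => ?_⟩
  refine le_of_forall_lt fun c hc => ?_
  obtain ⟨d, hcd, hd⟩ := exists_between hc
  exact hcd.trans_le <| le_lowerBaire_of_eventually <|
    (lowerSemicontinuous_iff.1 hφ.1 x d hd).mono fun y hy => hy.le.trans (hφ.2 y)

theorem isLeast_upperBaire (hf : LocallyBounded f) :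
    IsLeast (uscMajorants fun x => (f x).snd) (upperBaire f) := by
  have := isLeast_uscMajorants_neg_iff.2 (isGreatest_lowerBaire hf.neg)
  rw [lowerBaire_neg, neg_neg] at this
  convert this using 3 with x
  simp

end Baire

section Semicontinuous

variable {X : Type*} [TopologicalSpace X] {A : X → NonemptyInterval ℝ}

/-- An interval function is semicontinuous if its lower end point is lower semicontinuous and its
upper end point is upper semicontinuous. -/
structure IsSemicontinuous (A : X → NonemptyInterval ℝ) : Prop where
  lower : LowerSemicontinuous fun x => (A x).fst
  upper : UpperSemicontinuous fun x => (A x).snd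

namespace IsSemicontinuous

theorem neg (hA : IsSemicontinuous A) : IsSemicontinuous (-A) where
  lower := hA.upper.neg
  upper := hA.lower.neg

theorem isOpen_length_lt (hA : IsSemicontinuous A) (ε : ℝ) : IsOpen {x | (A x).length < ε} :=
  isOpen_sub_lt hA.upper hA.lower ε

theorem exists_eventually_le (hA : IsSemicontinuous A) (x : X) :
    ∃ a : NonemptyInterval ℝ, ∀ᶠ y in 𝓝 x, A y ≤ a := by
  refine ⟨⟨((A x).fst - 1, (A x).snd + 1), by linarith [(A x).fst_le_snd]⟩, ?_⟩
  filter_upwards [lowerSemicontinuous_iff.1 hA.lower x _ (sub_one_lt _),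
    upperSemicontinuous_iff.1 hA.upper x _ (lt_add_one _)] with y hlower hupper
  exact NonemptyInterval.le_def.2 ⟨hlower.le, hupper.le⟩

theorem isLeast_sInf_uscMajorants_fst (hA : IsSemicontinuous A) :
    IsLeast (uscMajorants fun x => (A x).fst) (sInf (uscMajorants fun x => (A x).fst)) :=
  isLeast_sInf_uscMajorants ⟨fun x => (A x).snd, hA.upper, fun x => (A x).fst_le_snd⟩

theorem isGreatest_sSup_lscMinorants_sInf (hA : IsSemicontinuous A) :
    IsGreatest (lscMinorants (sInf (uscMajorants fun x => (A x).fst)))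
      (sSup (lscMinorants (sInf (uscMajorants fun x => (A x).fst)))) :=
  isGreatest_sSup_lscMinorants
    ⟨fun x => (A x).fst, hA.lower, hA.isLeast_sInf_uscMajorants_fst.1.2⟩

theorem upperHemicontinuous (hA : IsSemicontinuous A) :
    UpperHemicontinuous fun x => (A x : Set ℝ) := by
  refine UpperHemicontinuous.of_forall_isOpen fun x U hU hAU => ?_
  obtain ⟨c, hc, hcU⟩ := exists_Ioc_subset_of_mem_nhds
    (hU.mem_nhds (hAU ⟨le_rfl, (A x).fst_le_snd⟩)) (exists_lt _)
  obtain ⟨d, hd, hdU⟩ := exists_Ico_subset_of_mem_nhds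
    (hU.mem_nhds (hAU ⟨(A x).fst_le_snd, le_rfl⟩)) (exists_gt _)
  filter_upwards [lowerSemicontinuous_iff.1 hA.lower x c hc,
    upperSemicontinuous_iff.1 hA.upper x d hd] with y hyc hyd t ht
  rcases le_or_gt t (A x).fst with hlow | hlow
  · exact hcU ⟨hyc.trans_le ht.1, hlow⟩
  rcases lt_or_ge t (A x).snd with hhigh | hhigh
  · exact hAU ⟨hlow.le, hhigh.le⟩
  · exact hdU ⟨hhigh, ht.2.trans_lt hyd⟩

end IsSemicontinuous

theorem isSemicontinuous_iff_upperHemicontinuous :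
    IsSemicontinuous A ↔ UpperHemicontinuous fun x => (A x : Set ℝ) := by
  refine ⟨IsSemicontinuous.upperHemicontinuous, fun h =>
    ⟨lowerSemicontinuous_iff.2 fun x c hc => ?_, upperSemicontinuous_iff.2 fun x c hc => ?_⟩⟩
  · exact (h.forall_isOpen x _ isOpen_Ioi
      fun t ht => hc.trans_le ht.1).mono fun y hy => hy ⟨le_rfl, (A y).fst_le_snd⟩
  · exact (h.forall_isOpen x _ isOpen_Iio
      fun t ht => ht.2.trans_lt hc).mono fun y hy => hy ⟨(A y).fst_le_snd, le_rfl⟩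

end Semicontinuous

theorem IsSemicontinuous.locallyBounded_of_le {X : Type*} [PseudoMetricSpace X]
    {A B : X → NonemptyInterval ℝ} (hA : IsSemicontinuous A) (hB : B ≤ A) : LocallyBounded B := by
  intro x
  obtain ⟨a, ha⟩ := hA.exists_eventually_le x
  obtain ⟨δ, hδ, hball⟩ := Metric.eventually_nhds_iff_ball.1 ha
  refine ⟨δ, hδ, max |a.fst| |a.snd| + 1, fun y hy => (lt_add_one _).trans_le' ?_⟩
  have hle := NonemptyInterval.le_def.1 ((hB y).trans (hball y hy))
  exact max_le (abs_le_max_abs_abs hle.1 ((B y).fst_le_snd.trans hle.2))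
    (abs_le_max_abs_abs (hle.1.trans (B y).fst_le_snd) hle.2)

namespace HFun

variable {X : Type*} [PseudoMetricSpace X] {A : X → NonemptyInterval ℝ} {f g : HFun X}

theorem graphCompletion_eq_of_le (f : HFun X) (hg : LocallyBounded A) (h : A ≤ f) :
    graphCompletion A hg = f :=
  funext <| f.hausdorff A hg fun x => NonemptyInterval.coe_subset_coe.2 (h x)

theorem isSemicontinuous (f : HFun X) : IsSemicontinuous f := by
  rw [← f.graphCompletion_eq_of_le f.locallyBounded le_rfl]
  exact ⟨(isGreatest_lowerBaire f.locallyBounded).1.1, (isLeast_upperBaire f.locallyBounded).1.1⟩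

theorem isLeast_snd (f : HFun X) :
    IsLeast (uscMajorants fun x => (f x).fst) fun x => (f x).snd := by
  have hle : (fun x => NonemptyInterval.pure (f x).fst) ≤ f := fun x =>
    NonemptyInterval.le_def.2 ⟨le_rfl, (f x).fst_le_snd⟩
  have hb := f.isSemicontinuous.locallyBounded_of_le hle
  have hsnd : upperBaire _ = fun x => (f x).snd := funext fun x =>
    congrArg (fun a => a.snd) (congrFun (f.graphCompletion_eq_of_le hb hle) x)
  exact hsnd ▸ isLeast_upperBaire hb

theorem isGreatest_fst (f : HFun X) :
    IsGreatest (lscMinorants fun x => (f x).snd) fun x => (f x).fst := by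
  have hle : (fun x => NonemptyInterval.pure (f x).snd) ≤ f := fun x =>
    NonemptyInterval.le_def.2 ⟨(f x).fst_le_snd, le_rfl⟩
  have hb := f.isSemicontinuous.locallyBounded_of_le hle
  have hfst : lowerBaire _ = fun x => (f x).fst := funext fun x =>
    congrArg (fun a => a.fst) (congrFun (f.graphCompletion_eq_of_le hb hle) x)
  exact hfst ▸ isGreatest_lowerBaire hb

/-- An interval function whose end points are semicontinuous envelopes of each other, as a
Hausdorff continuous function. -/
def ofEnvelopes (A : X → NonemptyInterval ℝ)
    (hsnd : IsLeast (uscMajorants fun x => (A x).fst) fun x => (A x).snd)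
    (hfst : IsGreatest (lscMinorants fun x => (A x).snd) fun x => (A x).fst) : HFun X where
  toFun := A
  locallyBounded := IsSemicontinuous.locallyBounded_of_le ⟨hfst.1.1, hsnd.1.1⟩ le_rfl
  hausdorff g hg hgA x := by
    have hle : ∀ y, (A y).fst ≤ (g y).fst ∧ (g y).snd ≤ (A y).snd := fun y =>
      NonemptyInterval.le_def.1 (NonemptyInterval.coe_subset_coe.1 (hgA y))
    have hlower := isGreatest_lowerBaire hg
    have hupper := isLeast_upperBaire hg
    refine NonemptyInterval.ext (Prod.ext (le_antisymm ?_ ?_) (le_antisymm ?_ ?_))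
    · exact hfst.2 ⟨hlower.1.1, fun y => (hlower.1.2 y).trans <|
        (g y).fst_le_snd.trans (hle y).2⟩ x
    · exact hlower.2 ⟨hfst.1.1, fun y => (hle y).1⟩ x
    · exact hupper.2 ⟨hsnd.1.1, fun y => (hle y).2⟩ x
    · exact hsnd.2 ⟨hupper.1.1, fun y => (hle y).1.trans <|
        (g y).fst_le_snd.trans (hupper.1.2 y)⟩ x

theorem le_iff_fst_le_snd : f ≤ g ↔ ∀ x, (f x).fst ≤ (g x).snd :=
  ⟨fun h x => (h x).1.trans (g x).fst_le_snd, fun h x =>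
    ⟨g.isGreatest_fst.2 ⟨f.isSemicontinuous.lower, h⟩ x,
      f.isLeast_snd.2 ⟨g.isSemicontinuous.upper, h⟩ x⟩⟩

theorem dense_length_lt (f : HFun X) {ε : ℝ} (hε : 0 < ε) : Dense {x | (f x).length < ε} :=
  dense_sub_lt_of_isLeast f.isLeast_snd hε

/-- The pointwise negative of a Hausdorff continuous function. -/
instance : Neg (HFun X) where
  neg f := ofEnvelopes (-f)
    (isLeast_uscMajorants_neg_iff.2 f.isGreatest_fst)
    (isGreatest_lscMinorants_neg_iff.2 f.isLeast_snd)

theorem le_neg : f ≤ -g ↔ g ≤ -f :=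
  forall_congr' fun _ => and_comm.trans (and_congr _root_.le_neg _root_.le_neg)

end HFun

namespace IsSemicontinuous

variable {X : Type*} [PseudoMetricSpace X] {A : X → NonemptyInterval ℝ} {r : HFun X}

/-- The least Hausdorff continuous function whose lower end point lies above that of a
semicontinuous interval function `A`: its upper end point is the upper semicontinuous envelope `u`
of the lower end point of `A`, and its lower end point is the lower semicontinuous envelope of
`u`. -/
noncomputable def lowerHull (hA : IsSemicontinuous A) : HFun X :=
  HFun.ofEnvelopes
    (fun x => ⟨(sSup (lscMinorants (sInf (uscMajorants fun x => (A x).fst))) x,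
      sInf (uscMajorants fun x => (A x).fst) x), hA.isGreatest_sSup_lscMinorants_sInf.1.2 x⟩)
    (isLeast_uscMajorants_of_isGreatest hA.lower hA.isLeast_sInf_uscMajorants_fst
      hA.isGreatest_sSup_lscMinorants_sInf)
    hA.isGreatest_sSup_lscMinorants_sInf

theorem isLeast_lowerHull_snd (hA : IsSemicontinuous A) :
    IsLeast (uscMajorants fun x => (A x).fst) fun x => (hA.lowerHull x).snd :=
  hA.isLeast_sInf_uscMajorants_fst

theorem lowerHull_le_iff (hA : IsSemicontinuous A) :
    hA.lowerHull ≤ r ↔ ∀ x, (A x).fst ≤ (r x).fst :=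
  ⟨fun h x => (hA.lowerHull.isGreatest_fst.2 ⟨hA.lower, hA.isLeast_lowerHull_snd.1.2⟩ x).trans
      (h x).1,
    fun h => HFun.le_iff_fst_le_snd.2 fun x => (hA.lowerHull x).fst_le_snd.trans <|
      hA.isLeast_lowerHull_snd.2
        ⟨r.isSemicontinuous.upper, fun y => (h y).trans (r y).fst_le_snd⟩ x⟩

theorem lowerHull_subset (hA : IsSemicontinuous A) (x : X) : hA.lowerHull x ≤ A x :=
  NonemptyInterval.le_def.2 ⟨hA.lowerHull_le_iff.1 le_rfl x,
    hA.isLeast_lowerHull_snd.2 ⟨hA.upper, fun y => (A y).fst_le_snd⟩ x⟩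

/-- The greatest Hausdorff continuous function whose upper end point lies below that of a
semicontinuous interval function. -/
noncomputable def upperHull (hA : IsSemicontinuous A) : HFun X :=
  -hA.neg.lowerHull

theorem isGreatest_upperHull_fst (hA : IsSemicontinuous A) :
    IsGreatest (lscMinorants fun x => (A x).snd) fun x => (hA.upperHull x).fst :=
  have hsnd : (-fun x => ((-A) x).fst) = fun x => (A x).snd := funext fun x => neg_neg (A x).snd
  hsnd ▸ isGreatest_lscMinorants_neg_iff.2 hA.neg.isLeast_lowerHull_snd

theorem le_upperHull_iff (hA : IsSemicontinuous A) :
    r ≤ hA.upperHull ↔ ∀ x, (r x).snd ≤ (A x).snd :=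
  HFun.le_neg.trans <| hA.neg.lowerHull_le_iff.trans <| forall_congr' fun _ => neg_le_neg_iff

end IsSemicontinuous

section Enclosure

/-- A sequence of semicontinuous interval functions which decreases for inclusion (the order `≤` of
`X → NonemptyInterval ℝ`) and, for every `ε > 0`, becomes shorter than `ε` at a dense set of
points. -/
structure IsEnclosure {X : Type*} [TopologicalSpace X] (A : ℕ → X → NonemptyInterval ℝ) :
    Prop where
  semicontinuous : ∀ n, IsSemicontinuous (A n)
  antitone : Antitone A
  dense : ∀ ε > 0, Dense {x | ∃ n, (A n x).length < ε}

variable {X : Type*} [PseudoMetricSpace X] {A : ℕ → X → NonemptyInterval ℝ} {f p r : HFun X}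

theorem HFun.isEnclosure_const (f : HFun X) : IsEnclosure fun _ : ℕ => f.toFun where
  semicontinuous _ := f.isSemicontinuous
  antitone := antitone_const
  dense _ hε := by simpa only [exists_const] using f.dense_length_lt hε

namespace IsEnclosure

theorem dense_length_lt_and {X : Type*} [TopologicalSpace X] {A B : ℕ → X → NonemptyInterval ℝ}
    (hA : IsEnclosure A) (hB : IsEnclosure B) {ε : ℝ} (hε : 0 < ε) :
    Dense {x | ∃ n, (A n x).length < ε ∧ (B n x).length < ε} := by
  have hopen : IsOpen {x | ∃ n, (A n x).length < ε} := by
    rw [Set.ofPred_exists]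
    exact isOpen_iUnion fun n => (hA.semicontinuous n).isOpen_length_lt ε
  refine ((hA.dense ε hε).inter_of_isOpen_left (hB.dense ε hε) hopen).mono ?_
  rintro x ⟨⟨n, hn⟩, k, hk⟩
  have hlength : ∀ {a b : NonemptyInterval ℝ}, a ≤ b → a.length ≤ b.length := fun hab =>
    sub_le_sub (NonemptyInterval.le_def.1 hab).2 (NonemptyInterval.le_def.1 hab).1
  exact ⟨max n k, (hlength (hA.antitone (le_max_left n k) x)).trans_lt hn,
    (hlength (hB.antitone (le_max_right n k) x)).trans_lt hk⟩

theorem le (hA : IsEnclosure A) (hr : ∀ n x, (A n x).fst ≤ (r x).fst)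
    (hp : ∀ n x, (p x).snd ≤ (A n x).snd) : p ≤ r := by
  refine HFun.le_iff_fst_le_snd.2 fun x => le_of_not_gt fun hx => ?_
  set ε := ((p x).fst - (r x).snd) / 2 with hε
  obtain ⟨y, hy, n, hn⟩ := (hA.dense ε (by linarith)).inter_open_nonempty _
    (isOpen_sub_lt r.isSemicontinuous.upper p.isSemicontinuous.lower (-ε))
    ⟨x, show (r x).snd - (p x).fst < -ε by linarith⟩
  have hgap : (r y).snd - (p y).fst < -ε := hy
  have hlength : (A n y).snd - (A n y).fst < ε := hn
  linarith [hr n y, hp n y, (p y).fst_le_snd, (r y).fst_le_snd]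

theorem eq (hA : IsEnclosure A) (hp : ∀ n x, p x ≤ A n x) (hr : ∀ n x, r x ≤ A n x) : p = r :=
  le_antisymm (hA.le (fun n x => (hr n x).1) fun n x => (hp n x).2)
    (hA.le (fun n x => (hp n x).1) fun n x => (hr n x).2)

theorem orderConverges (hA : IsEnclosure A) {ξ : ℕ → HFun X} (hξ : ∀ n x, ξ n x ≤ A n x)
    (hp : ∀ n x, p x ≤ A n x) : OrderConverges ξ p := by
  have hlower := fun n r => (hA.semicontinuous n).lowerHull_le_iff (r := r)
  have hupper := fun n r => (hA.semicontinuous n).le_upperHull_iff (r := r)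
  refine ⟨fun n => (hA.semicontinuous n).lowerHull, fun n => (hA.semicontinuous n).upperHull,
    fun n m hnm => (hlower n _).2 fun x => (hA.antitone hnm x).1.trans ((hlower m _).1 le_rfl x),
    fun n m hnm => (hupper n _).2 fun x => ((hupper m _).1 le_rfl x).trans (hA.antitone hnm x).2,
    fun n => ⟨(hlower n _).2 fun x => (hξ n x).1, (hupper n _).2 fun x => (hξ n x).2⟩,
    ⟨Set.forall_mem_range.2 fun n => (hlower n _).2 fun x => (hp n x).1, fun r hr => ?_⟩,
    ⟨Set.forall_mem_range.2 fun n => (hupper n _).2 fun x => (hp n x).2, fun r hr => ?_⟩⟩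
  · exact hA.le (fun n => (hlower n r).1 (hr ⟨n, rfl⟩)) fun n x => (hp n x).2
  · exact hA.le (fun n x => (hp n x).1) fun n => (hupper n r).1 (hr ⟨n, rfl⟩)

end IsEnclosure

theorem dense_exists_sub_lt_of_isLUB {ι : Type*} [Nonempty ι] {α : ι → HFun X}
    (hα : IsLUB (Set.range α) f) {ε : ℝ} (hε : 0 < ε) :
    Dense {x | ∃ i, (f x).snd - (α i x).fst < ε} := by
  have hαf : ∀ i x, (α i x).fst ≤ (f x).fst := fun i x => (hα.1 ⟨i, rfl⟩ x).1
  have hbdd : ∀ x, BddAbove (Set.range fun i => (α i x).fst) := fun x =>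
    ⟨(f x).fst, Set.forall_mem_range.2 fun i => hαf i x⟩
  have hA : IsSemicontinuous fun x => (⟨(⨆ i, (α i x).fst, (f x).snd),
      (ciSup_le fun i => hαf i x).trans (f x).fst_le_snd⟩ : NonemptyInterval ℝ) :=
    ⟨lowerSemicontinuous_ciSup hbdd fun i => (α i).isSemicontinuous.lower,
      f.isSemicontinuous.upper⟩
  have hf : f ≤ hA.lowerHull := hα.2 <| Set.forall_mem_range.2 fun i =>
    HFun.le_iff_fst_le_snd.2 fun x => (le_ciSup (hbdd x) i).trans (hA.isLeast_lowerHull_snd.1.2 x)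
  refine (dense_sub_lt_of_isLeast hA.isLeast_lowerHull_snd hε).mono fun x hx => ?_
  obtain ⟨i, hi⟩ := exists_lt_of_lt_ciSup <|
    sub_lt_comm.1 (hx.trans_le' (sub_le_sub_right (hf x).2 _))
  exact ⟨i, sub_lt_comm.1 hi⟩

theorem dense_exists_sub_lt_of_isGLB {ι : Type*} [Nonempty ι] {β : ι → HFun X}
    (hβ : IsGLB (Set.range β) f) {ε : ℝ} (hε : 0 < ε) :
    Dense {x | ∃ i, (β i x).snd - (f x).fst < ε} := by
  have hfβ : ∀ i x, (f x).snd ≤ (β i x).snd := fun i x => (hβ.1 ⟨i, rfl⟩ x).2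
  have hbdd : ∀ x, BddBelow (Set.range fun i => (β i x).snd) := fun x =>
    ⟨(f x).snd, Set.forall_mem_range.2 fun i => hfβ i x⟩
  have hA : IsSemicontinuous fun x => (⟨((f x).fst, ⨅ i, (β i x).snd),
      (f x).fst_le_snd.trans (le_ciInf fun i => hfβ i x)⟩ : NonemptyInterval ℝ) :=
    ⟨f.isSemicontinuous.lower,
      upperSemicontinuous_ciInf hbdd fun i => (β i).isSemicontinuous.upper⟩
  have hf : hA.upperHull ≤ f := hβ.2 <| Set.forall_mem_range.2 fun i =>
    HFun.le_iff_fst_le_snd.2 fun x =>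
      (hA.isGreatest_upperHull_fst.1.2 x).trans (ciInf_le (hbdd x) i)
  refine (dense_sub_lt_of_isGreatest hA.isGreatest_upperHull_fst hε).mono fun x hx => ?_
  obtain ⟨i, hi⟩ := exists_lt_of_ciInf_lt <|
    sub_lt_iff_lt_add.1 (hx.trans_le' (sub_le_sub_left (hf x).1 _))
  exact ⟨i, sub_lt_iff_lt_add.2 hi⟩

theorem OrderConverges.exists_isEnclosure {ξ : ℕ → HFun X} (h : OrderConverges ξ f) :
    ∃ A : ℕ → X → NonemptyInterval ℝ, IsEnclosure A ∧ (∀ n x, ξ n x ≤ A n x) ∧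
      ∀ n x, f x ≤ A n x := by
  obtain ⟨α, β, hα, hβ, hξ, hlub, hglb⟩ := h
  have hαf : ∀ n, α n ≤ f := fun n => hlub.1 ⟨n, rfl⟩
  have hfβ : ∀ n, f ≤ β n := fun n => hglb.1 ⟨n, rfl⟩
  refine ⟨fun n x => ⟨((α n x).fst, (β n x).snd), HFun.le_iff_fst_le_snd.1
      ((hαf n).trans (hfβ n)) x⟩, ⟨fun n => ⟨(α n).isSemicontinuous.lower,
      (β n).isSemicontinuous.upper⟩, fun n m hnm x => ⟨(hα hnm x).1, (hβ hnm x).2⟩,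
      fun ε hε => ?_⟩, fun n x => ⟨((hξ n).1 x).1, ((hξ n).2 x).2⟩,
    fun n x => ⟨(hαf n x).1, (hfβ n x).2⟩⟩
  have hopen : IsOpen {x | ∃ n, (f x).snd - (α n x).fst < ε / 2} := by
    rw [Set.ofPred_exists]
    exact isOpen_iUnion fun n =>
      isOpen_sub_lt f.isSemicontinuous.upper (α n).isSemicontinuous.lower _
  refine ((dense_exists_sub_lt_of_isLUB hlub (half_pos hε)).inter_of_isOpen_left
    (dense_exists_sub_lt_of_isGLB hglb (half_pos hε)) hopen).mono ?_
  rintro x ⟨⟨n, hn⟩, m, hm⟩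
  refine ⟨max n m, ?_⟩
  have hαmax := (hα (le_max_left n m) x).1
  have hβmax := (hβ (le_max_right n m) x).2
  change (β (max n m) x).snd - (α (max n m) x).fst < ε
  linarith [(f x).fst_le_snd]

end Enclosure

section OrderConverges

variable {P : Type*} [PartialOrder P] {ξ : ℕ → P} {p q : P}

theorem OrderConverges.le (hp : OrderConverges ξ p) (hq : OrderConverges ξ q) : p ≤ q := by
  obtain ⟨α, _, hα, -, hξα, hlub, -⟩ := hp
  obtain ⟨_, β, -, hβ, hξβ, -, hglb⟩ := hq
  refine hlub.2 <| Set.forall_mem_range.2 fun n => hglb.2 <| Set.forall_mem_range.2 fun m => ?_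
  calc α n ≤ α (max n m) := hα (le_max_left n m)
    _ ≤ ξ (max n m) := (hξα _).1
    _ ≤ β (max n m) := (hξβ _).2
    _ ≤ β m := hβ (le_max_right n m)

theorem OrderConverges.isTheOrderLimit (hp : OrderConverges ξ p) : IsTheOrderLimit ξ p :=
  ⟨hp, fun _ hq => le_antisymm (hq.le hp) (hp.le hq)⟩

end OrderConverges

section UnitedExtension

/-- `op` is the united extension of `m` to intervals: `op a b` is the range of `m` on the box
`a × b`. -/
def IsUnitedExtension (op : NonemptyInterval ℝ → NonemptyInterval ℝ → NonemptyInterval ℝ)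
    (m : C(ℝ × ℝ, ℝ)) : Prop :=
  ∀ a b, (op a b : Set ℝ) = m '' ((a : Set ℝ) ×ˢ (b : Set ℝ))

variable {op : NonemptyInterval ℝ → NonemptyInterval ℝ → NonemptyInterval ℝ} {m : C(ℝ × ℝ, ℝ)}

theorem isUnitedExtension_of_endpoints
    (hsub : ∀ a b : NonemptyInterval ℝ, m '' ((a : Set ℝ) ×ˢ (b : Set ℝ)) ⊆ op a b)
    (hfst : ∀ a b : NonemptyInterval ℝ, (op a b).fst ∈ m '' ((a : Set ℝ) ×ˢ (b : Set ℝ)))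
    (hsnd : ∀ a b : NonemptyInterval ℝ, (op a b).snd ∈ m '' ((a : Set ℝ) ×ˢ (b : Set ℝ))) :
    IsUnitedExtension op m := fun a b =>
  (((isPreconnected_Icc.prod isPreconnected_Icc).image m m.continuous.continuousOn).Icc_subset
    (hfst a b) (hsnd a b)).antisymm (hsub a b)

theorem isUnitedExtension_add : IsUnitedExtension (· + ·) (.fst + .snd) :=
  isUnitedExtension_of_endpoints
    (fun _ _ => Set.image_subset_iff.2 fun _ hst =>
      ⟨add_le_add hst.1.1 hst.2.1, add_le_add hst.1.2 hst.2.2⟩)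
    (fun a b => ⟨(a.fst, b.fst), ⟨⟨le_rfl, a.fst_le_snd⟩, le_rfl, b.fst_le_snd⟩, rfl⟩)
    (fun a b => ⟨(a.snd, b.snd), ⟨⟨a.fst_le_snd, le_rfl⟩, b.fst_le_snd, le_rfl⟩, rfl⟩)

theorem intervalMul_endpoints_mem {a b : NonemptyInterval ℝ} {S : Set ℝ}
    (hff : a.fst * b.fst ∈ S) (hfs : a.fst * b.snd ∈ S) (hsf : a.snd * b.fst ∈ S)
    (hss : a.snd * b.snd ∈ S) : (intervalMul a b).fst ∈ S ∧ (intervalMul a b).snd ∈ S :=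
  ⟨min_rec' (· ∈ S) (min_rec' (· ∈ S) hff hfs) (min_rec' (· ∈ S) hsf hss),
    max_rec' (· ∈ S) (max_rec' (· ∈ S) hff hfs) (max_rec' (· ∈ S) hsf hss)⟩

theorem mul_mem_of_corners_mem {a b : NonemptyInterval ℝ} {S : Set ℝ} [hS : S.OrdConnected]
    (hff : a.fst * b.fst ∈ S) (hfs : a.fst * b.snd ∈ S) (hsf : a.snd * b.fst ∈ S)
    (hss : a.snd * b.snd ∈ S) {s t : ℝ} (hs : s ∈ a) (ht : t ∈ b) : s * t ∈ S := by
  have hedge : ∀ r, r * b.fst ∈ S → r * b.snd ∈ S → r * t ∈ S := fun r hfst hsnd =>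
    hS.uIcc_subset hfst hsnd <|
      Set.image_const_mul_uIcc r _ _ ▸ Set.mem_image_of_mem _ (Set.Icc_subset_uIcc ht)
  exact hS.uIcc_subset (hedge _ hff hfs) (hedge _ hsf hss) <|
    Set.image_mul_const_uIcc t _ _ ▸ Set.mem_image_of_mem _ (Set.Icc_subset_uIcc hs)

theorem mul_mem_intervalMul {a b : NonemptyInterval ℝ} {s t : ℝ} (hs : s ∈ a) (ht : t ∈ b) :
    s * t ∈ intervalMul a b := by
  refine mul_mem_of_corners_mem (S := Set.Icc (intervalMul a b).fst (intervalMul a b).snd)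
    ?_ ?_ ?_ ?_ hs ht <;> simp [intervalMul]

theorem isUnitedExtension_mul : IsUnitedExtension intervalMul (.fst * .snd) := by
  have hcorners : ∀ a b : NonemptyInterval ℝ,
      (intervalMul a b).fst ∈ (.fst * .snd : C(ℝ × ℝ, ℝ)) '' ((a : Set ℝ) ×ˢ (b : Set ℝ)) ∧
      (intervalMul a b).snd ∈ (.fst * .snd : C(ℝ × ℝ, ℝ)) '' ((a : Set ℝ) ×ˢ (b : Set ℝ)) :=
    fun a b => intervalMul_endpoints_mem
      ⟨(a.fst, b.fst), ⟨⟨le_rfl, a.fst_le_snd⟩, le_rfl, b.fst_le_snd⟩, rfl⟩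
      ⟨(a.fst, b.snd), ⟨⟨le_rfl, a.fst_le_snd⟩, b.fst_le_snd, le_rfl⟩, rfl⟩
      ⟨(a.snd, b.fst), ⟨⟨a.fst_le_snd, le_rfl⟩, le_rfl, b.fst_le_snd⟩, rfl⟩
      ⟨(a.snd, b.snd), ⟨⟨a.fst_le_snd, le_rfl⟩, b.fst_le_snd, le_rfl⟩, rfl⟩
  exact isUnitedExtension_of_endpoints
    (fun _ _ => Set.image_subset_iff.2 fun _ hst => mul_mem_intervalMul hst.1 hst.2)
    (fun a b => (hcorners a b).1) fun a b => (hcorners a b).2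

namespace IsUnitedExtension

theorem mono (hop : IsUnitedExtension op m) {a a' b b' : NonemptyInterval ℝ} (ha : a ≤ a')
    (hb : b ≤ b') : op a b ≤ op a' b' := by
  rw [← NonemptyInterval.coe_subset_coe, hop, hop]
  exact Set.image_mono (Set.prod_mono (NonemptyInterval.coe_subset_coe.2 ha)
    (NonemptyInterval.coe_subset_coe.2 hb))

theorem isSemicontinuous (hop : IsUnitedExtension op m) {X : Type*} [TopologicalSpace X]
    {A B : X → NonemptyInterval ℝ} (hA : IsSemicontinuous A) (hB : IsSemicontinuous B) :
    IsSemicontinuous fun x => op (A x) (B x) := by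
  refine isSemicontinuous_iff_upperHemicontinuous.2 <| .of_forall_isOpen fun x W hW hxW => ?_
  rw [hop, Set.image_subset_iff] at hxW
  obtain ⟨U, V, hU, hV, hAU, hBV, hUV⟩ :=
    generalized_tube_lemma isCompact_Icc isCompact_Icc (hW.preimage m.continuous) hxW
  filter_upwards [hA.upperHemicontinuous.forall_isOpen x U hU hAU,
    hB.upperHemicontinuous.forall_isOpen x V hV hBV] with y hyU hyV
  rw [hop, Set.image_subset_iff]
  exact (Set.prod_mono hyU hyV).trans hUV

theorem exists_length_lt (hop : IsUnitedExtension op m) (a₀ b₀ : NonemptyInterval ℝ) {ε : ℝ}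
    (hε : 0 < ε) : ∃ δ > 0, ∀ a ≤ a₀, ∀ b ≤ b₀, a.length < δ → b.length < δ →
      (op a b).length < ε := by
  obtain ⟨δ, hδ, hm⟩ := Metric.uniformContinuousOn_iff.1
    ((isCompact_Icc.prod isCompact_Icc).uniformContinuousOn_of_continuous
      m.continuous.continuousOn : UniformContinuousOn m ((a₀ : Set ℝ) ×ˢ (b₀ : Set ℝ))) ε hε
  refine ⟨δ, hδ, fun a ha b hb haδ hbδ => ?_⟩
  have hbox := Set.prod_mono (NonemptyInterval.coe_subset_coe.2 ha)
    (NonemptyInterval.coe_subset_coe.2 hb)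
  have hfst : (op a b).fst ∈ (op a b : Set ℝ) := ⟨le_rfl, (op a b).fst_le_snd⟩
  have hsnd : (op a b).snd ∈ (op a b : Set ℝ) := ⟨(op a b).fst_le_snd, le_rfl⟩
  rw [hop] at hfst hsnd
  obtain ⟨p, hp, hpfst⟩ := hfst
  obtain ⟨q, hq, hqsnd⟩ := hsnd
  have hqp : dist q p < δ := max_lt ((Real.dist_le_of_mem_Icc hq.1 hp.1).trans_lt haδ)
    ((Real.dist_le_of_mem_Icc hq.2 hp.2).trans_lt hbδ)
  calc (op a b).length = m q - m p := by rw [hpfst, hqsnd]; rfl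
    _ ≤ dist (m q) (m p) := le_abs_self _
    _ < ε := hm q (hbox hq) p (hbox hp) hqp

theorem isEnclosure (hop : IsUnitedExtension op m) {X : Type*} [TopologicalSpace X]
    {A B : ℕ → X → NonemptyInterval ℝ} (hA : IsEnclosure A) (hB : IsEnclosure B) :
    IsEnclosure fun n x => op (A n x) (B n x) where
  semicontinuous n := hop.isSemicontinuous (hA.semicontinuous n) (hB.semicontinuous n)
  antitone _ _ hnk x := hop.mono (hA.antitone hnk x) (hB.antitone hnk x)
  dense ε hε := by
    refine dense_iff_inter_open.2 fun U hU ⟨x, hx⟩ => ?_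
    obtain ⟨a₀, ha₀⟩ := (hA.semicontinuous 0).exists_eventually_le x
    obtain ⟨b₀, hb₀⟩ := (hB.semicontinuous 0).exists_eventually_le x
    obtain ⟨δ, hδ, hlength⟩ := hop.exists_length_lt a₀ b₀ hε
    obtain ⟨y, ⟨hyU, hya, hyb⟩, n, hAn, hBn⟩ := mem_closure_iff_nhds.1
      (hA.dense_length_lt_and hB hδ x) _ ((hU.eventually_mem hx).and (ha₀.and hb₀))
    exact ⟨y, hyU, n, hlength _ ((hA.antitone n.zero_le y).trans hya) _
      ((hB.antitone n.zero_le y).trans hyb) hAn hBn⟩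

end IsUnitedExtension

end UnitedExtension

section LipschitzRegularization

open scoped NNReal

variable {X : Type*} [PseudoMetricSpace X] {φ ψ : X → ℝ} {K L : ℝ≥0}

/-- The Lipschitz regularization of `φ` with constant `K`, for `φ` bounded below: the greatest
`K`-Lipschitz function below `φ`. -/
noncomputable def lipschitzRegularization (φ : X → ℝ) (K : ℝ≥0) (x : X) : ℝ :=
  ⨅ y, (φ y + K * dist x y)

theorem bddBelow_range_add_mul_dist (hφ : BddBelow (Set.range φ)) (K : ℝ≥0) (x : X) :
    BddBelow (Set.range fun y => φ y + K * dist x y) := by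
  obtain ⟨b, hb⟩ := hφ
  exact ⟨b, Set.forall_mem_range.2 fun y =>
    (hb ⟨y, rfl⟩).trans (le_add_of_nonneg_right (mul_nonneg K.2 dist_nonneg))⟩

theorem lipschitzRegularization_le (hφ : BddBelow (Set.range φ)) (K : ℝ≥0) (x : X) :
    lipschitzRegularization φ K x ≤ φ x := by
  simpa only [lipschitzRegularization, dist_self, mul_zero, add_zero] using
    ciInf_le (bddBelow_range_add_mul_dist hφ K x) x

theorem lipschitzWith_lipschitzRegularization (hφ : BddBelow (Set.range φ)) (K : ℝ≥0) :
    LipschitzWith K (lipschitzRegularization φ K) := by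
  refine LipschitzWith.of_le_add_mul K fun x x' => ?_
  have : Nonempty X := ⟨x⟩
  refine sub_le_iff_le_add.1 <| le_ciInf fun y => sub_le_iff_le_add.2 ?_
  calc lipschitzRegularization φ K x ≤ φ y + K * dist x y :=
        ciInf_le (bddBelow_range_add_mul_dist hφ K x) y
    _ ≤ φ y + K * (dist x x' + dist x' y) := by gcongr; exact dist_triangle x x' y
    _ = φ y + K * dist x' y + K * dist x x' := by ring

theorem lipschitzRegularization_mono (hφ : BddBelow (Set.range φ)) (hKL : K ≤ L) :
    lipschitzRegularization φ K ≤ lipschitzRegularization φ L := fun x =>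
  ciInf_mono (bddBelow_range_add_mul_dist hφ K x) fun y => by gcongr

theorem isLUB_lipschitzRegularization (hbdd : BddBelow (Set.range φ))
    (hφ : LowerSemicontinuous φ) (x : X) :
    IsLUB (Set.range fun n : ℕ => lipschitzRegularization φ n x) (φ x) := by
  refine ⟨Set.forall_mem_range.2 fun n => lipschitzRegularization_le hbdd n x, fun a ha => ?_⟩
  refine le_of_forall_lt_imp_le_of_dense fun c hc => ?_
  obtain ⟨b, hb⟩ := hbdd
  obtain ⟨δ, hδ, hball⟩ := Metric.eventually_nhds_iff_ball.1 (lowerSemicontinuous_iff.1 hφ x c hc)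
  obtain ⟨n, hn⟩ := exists_nat_ge ((c - b) / δ)
  have : Nonempty X := ⟨x⟩
  refine le_trans (le_ciInf fun y => ?_) (ha ⟨n, rfl⟩)
  by_cases hy : y ∈ Metric.ball x δ
  · exact (hball y hy).le.trans (le_add_of_nonneg_right (mul_nonneg n.cast_nonneg dist_nonneg))
  · rw [Metric.mem_ball', not_lt] at hy
    calc c ≤ b + n * δ := by linarith [(div_le_iff₀ hδ).1 hn]
      _ ≤ φ y + (n : ℝ≥0) * dist x y := by
        rw [NNReal.coe_natCast]
        gcongr
        exact hb ⟨y, rfl⟩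

theorem exists_continuousMap_le (hφ : LowerSemicontinuous φ) : ∃ b : C(X, ℝ), ∀ x, b x ≤ φ x :=
  exists_continuous_forall_mem_convex_of_local_const (t := fun x => Set.Iic (φ x))
    (fun _ => convex_Iic _) fun x =>
      ⟨φ x - 1, (lowerSemicontinuous_iff.1 hφ x _ (sub_one_lt _)).mono fun _ hy => hy.le⟩

theorem exists_monotone_continuousMap_isLUB (hφ : LowerSemicontinuous φ) :
    ∃ l : ℕ → C(X, ℝ), Monotone l ∧ ∀ x, IsLUB (Set.range fun n => l n x) (φ x) := by
  obtain ⟨b, hb⟩ := exists_continuousMap_le hφ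
  have hbdd : BddBelow (Set.range (φ + ⇑(-b))) :=
    ⟨0, Set.forall_mem_range.2 fun x => (sub_nonneg.2 (hb x)).trans_eq (sub_eq_add_neg _ _)⟩
  have hlsc : LowerSemicontinuous (φ + ⇑(-b)) :=
    hφ.add (-b).continuous.lowerSemicontinuous
  refine ⟨fun n => ⟨_, (lipschitzWith_lipschitzRegularization hbdd n).continuous⟩ + b,
    fun n k hnk => add_le_add_left (lipschitzRegularization_mono hbdd (by gcongr)) b, fun x => ?_⟩
  have hlub := (OrderIso.addRight (b x)).isLUB_image'.2
    (isLUB_lipschitzRegularization hbdd hlsc x)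
  rw [← Set.range_comp] at hlub
  rw [← neg_add_cancel_right (φ x) (b x)]
  exact hlub

theorem exists_antitone_continuousMap_isGLB (hψ : UpperSemicontinuous ψ) :
    ∃ u : ℕ → C(X, ℝ), Antitone u ∧ ∀ x, IsGLB (Set.range fun n => u n x) (ψ x) := by
  obtain ⟨l, hl, hlub⟩ := exists_monotone_continuousMap_isLUB hψ.neg
  refine ⟨-l, fun n k hnk => neg_le_neg (hl hnk), fun x => ?_⟩
  have hglb := isGLB_neg.2 (hlub x)
  rwa [← Set.image_neg_eq_neg, ← Set.range_comp] at hglb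

end LipschitzRegularization

section Approximation

variable {X : Type*} [PseudoMetricSpace X] {A : ℕ → X → NonemptyInterval ℝ}

theorem HFun.exists_isEnclosure_continuous (f : HFun X) :
    ∃ A : ℕ → X → NonemptyInterval ℝ, IsEnclosure A ∧ (∀ n x, f x ≤ A n x) ∧
      (∀ n, Continuous fun x => (A n x).fst) ∧ ∀ n, Continuous fun x => (A n x).snd := by
  obtain ⟨l, hl, hlub⟩ := exists_monotone_continuousMap_isLUB f.isSemicontinuous.lower
  obtain ⟨u, hu, hglb⟩ := exists_antitone_continuousMap_isGLB f.isSemicontinuous.upper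
  have hlf : ∀ n x, l n x ≤ (f x).fst := fun n x => (hlub x).1 ⟨n, rfl⟩
  have hfu : ∀ n x, (f x).snd ≤ u n x := fun n x => (hglb x).1 ⟨n, rfl⟩
  refine ⟨fun n x => ⟨(l n x, u n x), (hlf n x).trans ((f x).fst_le_snd.trans (hfu n x))⟩,
    ⟨fun n => ⟨(l n).continuous.lowerSemicontinuous, (u n).continuous.upperSemicontinuous⟩,
      fun n k hnk x => ⟨hl hnk x, hu hnk x⟩, fun ε hε => ?_⟩,
    fun n x => ⟨hlf n x, hfu n x⟩, fun n => (l n).continuous, fun n => (u n).continuous⟩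
  refine (f.dense_length_lt (ε := ε / 3) (by positivity)).mono fun x hx => ?_
  have hlength : (f x).snd - (f x).fst < ε / 3 := hx
  obtain ⟨_, ⟨n, rfl⟩, hn⟩ := (lt_isLUB_iff (hlub x)).1 (sub_lt_self _ (by positivity : 0 < ε / 3))
  obtain ⟨_, ⟨k, rfl⟩, hk⟩ := (isGLB_lt_iff (hglb x)).1
    (lt_add_of_pos_right _ (by positivity : 0 < ε / 3))
  refine ⟨max n k, ?_⟩
  have hlmax : l n x ≤ l (max n k) x := hl (le_max_left n k) x
  have humax : u (max n k) x ≤ u k x := hu (le_max_right n k) x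
  change u (max n k) x - l (max n k) x < ε
  linarith

theorem IsEnclosure.isOrderCauchy (hA : IsEnclosure A)
    (hfst : ∀ n, Continuous fun x => (A n x).fst) (hsnd : ∀ n, Continuous fun x => (A n x).snd)
    {u : ℕ → C(X, ℝ)} (hu : ∀ n x, u n x ∈ A n x) : IsOrderCauchy u := by
  refine ⟨fun n => ⟨_, (hsnd n).sub (hfst n)⟩, fun n k hnk x =>
    sub_le_sub (hA.antitone hnk x).2 (hA.antitone hnk x).1,
    ⟨Set.forall_mem_range.2 fun n x => sub_nonneg.2 (A n x).fst_le_snd, fun c hc x => ?_⟩,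
    fun n k j hk hj x => ?_⟩
  · refine le_of_not_gt fun hx : 0 < c x => ?_
    obtain ⟨y, hy, n, hn⟩ := (hA.dense (c x / 2) (half_pos hx)).inter_open_nonempty _
      (isOpen_Ioi.preimage c.continuous) ⟨x, half_lt_self hx⟩
    have hcn : c y ≤ (A n y).length := hc ⟨n, rfl⟩ y
    exact ((hcn.trans_lt hn).trans hy).false
  · exact sub_le_sub ((NonemptyInterval.coe_subset_coe.2 (hA.antitone hk x)) (hu k x)).2
      ((NonemptyInterval.coe_subset_coe.2 (hA.antitone hj x)) (hu j x)).1

theorem exists_approximates (f : HFun X) : ∃ u : ℕ → C(X, ℝ), Approximates u f := by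
  obtain ⟨A, hA, hfA, hfst, hsnd⟩ := f.exists_isEnclosure_continuous
  exact ⟨fun n => ⟨_, hfst n⟩,
    hA.isOrderCauchy hfst hsnd fun n x => ⟨le_rfl, (A n x).fst_le_snd⟩,
    hA.orderConverges (fun n x => ⟨le_rfl, (A n x).fst_le_snd⟩) hfA⟩

end Approximation

section Operation

variable {X : Type*} [PseudoMetricSpace X]
  {op : NonemptyInterval ℝ → NonemptyInterval ℝ → NonemptyInterval ℝ} {m : C(ℝ × ℝ, ℝ)}

/-- `h` is a result of the interval operation `op` on `f` and `g` in the sense of inclusion. -/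
def IsInclusionResult (op : NonemptyInterval ℝ → NonemptyInterval ℝ → NonemptyInterval ℝ)
    (f g h : HFun X) : Prop :=
  ∀ x, (h x : Set ℝ) ⊆ (op (f x) (g x) : Set ℝ)

/-- `h` is the result of the operation `m` on `f` and `g` in the sense of order convergence. -/
def IsOrderResult (m : C(ℝ × ℝ, ℝ)) (f g h : HFun X) : Prop :=
  (∃ u v : ℕ → C(X, ℝ), Approximates u f ∧ Approximates v g) ∧
  ∀ u v : ℕ → C(X, ℝ), Approximates u f → Approximates v g →
    IsTheOrderLimit (fun n => ofContinuous (m.comp ((u n).prodMk (v n)))) h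

variable {f g h : HFun X}

theorem IsUnitedExtension.existsUnique_isInclusionResult (hop : IsUnitedExtension op m)
    (f g : HFun X) : ∃! h, IsInclusionResult op f g h := by
  have hA := hop.isSemicontinuous f.isSemicontinuous g.isSemicontinuous
  refine ⟨hA.lowerHull, fun x => NonemptyInterval.coe_subset_coe.2 (hA.lowerHull_subset x),
    fun r hr => ?_⟩
  exact (hop.isEnclosure f.isEnclosure_const g.isEnclosure_const).eq
    (fun _ x => NonemptyInterval.coe_subset_coe.1 (hr x)) fun _ => hA.lowerHull_subset

theorem IsUnitedExtension.isTheOrderLimit (hop : IsUnitedExtension op m)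
    (hh : IsInclusionResult op f g h) {u v : ℕ → C(X, ℝ)}
    (hu : OrderConverges (fun n => ofContinuous (u n)) f)
    (hv : OrderConverges (fun n => ofContinuous (v n)) g) :
    IsTheOrderLimit (fun n => ofContinuous (m.comp ((u n).prodMk (v n)))) h := by
  obtain ⟨A, hA, huA, hfA⟩ := hu.exists_isEnclosure
  obtain ⟨B, hB, hvB, hgB⟩ := hv.exists_isEnclosure
  refine ((hop.isEnclosure hA hB).orderConverges (fun n x => ?_) fun n x =>
    (NonemptyInterval.coe_subset_coe.1 (hh x)).trans
      (hop.mono (hfA n x) (hgB n x))).isTheOrderLimit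
  have hmem : m (u n x, v n x) ∈ (op (A n x) (B n x) : Set ℝ) :=
    hop (A n x) (B n x) ▸ Set.mem_image_of_mem m ⟨huA n x, hvB n x⟩
  exact hmem

theorem IsUnitedExtension.isInclusionResult_iff (hop : IsUnitedExtension op m) :
    IsInclusionResult op f g h ↔ IsOrderResult m f g h := by
  obtain ⟨u, hu⟩ := exists_approximates f
  obtain ⟨v, hv⟩ := exists_approximates g
  refine ⟨fun hh => ⟨⟨u, v, hu, hv⟩, fun u v hu hv => hop.isTheOrderLimit hh hu.2 hv.2⟩,
    fun hh => ?_⟩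
  obtain ⟨q, hq, -⟩ := hop.existsUnique_isInclusionResult f g
  exact (hop.isTheOrderLimit hq hu.2 hv.2).2 h (hh.2 u v hu hv).1 ▸ hq

end Operation

end HausdorffContinuity

open HausdorffContinuity in
theorem theorem7_general {X : Type*} [PseudoMetricSpace X]
    {op : NonemptyInterval ℝ → NonemptyInterval ℝ → NonemptyInterval ℝ} {m : C(ℝ × ℝ, ℝ)}
    (hop : IsUnitedExtension op m) (f g : HFun X) :
    (∃! h, IsInclusionResult op f g h) ∧ (∃! h, IsOrderResult m f g h) ∧
      ∀ h, IsInclusionResult op f g h ↔ IsOrderResult m f g h := by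
  have hiff : ∀ h, IsInclusionResult op f g h ↔ IsOrderResult m f g h := fun _ =>
    hop.isInclusionResult_iff
  have hexists := hop.existsUnique_isInclusionResult f g
  exact ⟨hexists, (existsUnique_congr hiff).1 hexists, hiff⟩

/-- For all Hausdorff continuous `f`, `g`, both definitions of the sum and both definitions of
the product determine exactly one Hausdorff continuous function, and it is the same one. -/
theorem theorem7 {n : ℕ} (Ω : Set (EuclideanSpace ℝ (Fin n)))
    (f g : HausdorffContinuity.HFun Ω) :
    ((∃! h, HausdorffContinuity.IsInclusionSum f g h) ∧
      (∃! h, HausdorffContinuity.IsOrderSum f g h) ∧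
      ∀ h, HausdorffContinuity.IsInclusionSum f g h ↔ HausdorffContinuity.IsOrderSum f g h) ∧
    ((∃! h, HausdorffContinuity.IsInclusionProd f g h) ∧
      (∃! h, HausdorffContinuity.IsOrderProd f g h) ∧
      ∀ h, HausdorffContinuity.IsInclusionProd f g h ↔
        HausdorffContinuity.IsOrderProd f g h) :=
  ⟨theorem7_general HausdorffContinuity.isUnitedExtension_add f g,
    theorem7_general HausdorffContinuity.isUnitedExtension_mul f g⟩
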